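/- Conventions. Let $A$ be an integral domain with quotient field $K$, and let $\boldsymbol F(A)$ be the set of nonzero fractional ideals of $A$; for $E\in\boldsymbol F(A)$ put $E^{-1}=(A:_K E)=\{y\in K: yE\subseteq A\}$ and $E^{v_A}=(E^{-1})^{-1}$. A star operation on $A$ is a map $\ast:\boldsymbol F(A)\to\boldsymbol F(A)$, $E\mapsto E^\ast$, such that for all $0\neq x\in K$ and $E,F\in\boldsymbol F(A)$: $(xA)^\ast=xA$ and $(xE)^\ast=xE^\ast$; $E\subseteq F$ implies $E^\ast\subseteq F^\ast$; $E\subseteq E^\ast$ and $(E^\ast)^\ast=E^\ast$. It is of finite type if $E^\ast=\bigcup\{F^\ast: F\subseteq E,\ F\in\boldsymbol F(A)\text{ finitely generated}\}$ for all $E\in\boldsymbol F(A)$. Let $\operatorname{Inv}^\ast(A)$ be the abelian group of all $I\in\boldsymbol F(A)$ with $I^\ast=I$ and $(II^{-1})^\ast=A$, under the product $(I,J)\mapsto(IJ)^\ast$, and let $\operatorname{Cl}^\ast(A)$ be the quotient of $\operatorname{Inv}^\ast(A)$ by its subgroup of nonzero principal fractional ideals; $[I]$ denotes the class of $I$. Write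 $\mathcal U(A)$ for the group of units of $A$. Theorem. Let $T$ be an integral domain, $M$ a nonzero maximal ideal of $T$, $k=T/M$, $\varphi:T\to k$ the canonical projection, $D$ a proper subring of $k$ whose quotient field is $k$, and $R=\varphi^{-1}(D)$. (Then $R$ and $T$ have the same quotient field and $(R:T)=M\neq 0$, so every nonzero fractional ideal of $T$ is a nonzero fractional ideal of $R$.) Let $\ast$ be a star operation of finite type on $R$, and let $(\ast)_T$ be the star operation on $T$ defined by $$E^{(\ast)_T}=E^\ast\cap E^{v_T}\qquad(E\in\boldsymbol F(T)).$$ Suppose that the homomorphism $\mathcal U(T)\to k^\bullet/\mathcal U(D)$ induced by $\varphi$ is surjective, where $k^\bullet=k\setminus\{0\}$. Then $HT\in\operatorname{Inv}^{(\ast)_T}(T)$ for every $H\in\operatorname{Inv}^\ast(R)$, and $[H]\mapsto[HT]$ is a well-defined group homomorphism $$\overline{\boldsymbol\beta}:\operatorname{Cl}^\ast(R)\to\operatorname{Cl}^{(\ast)_T}(T),$$ which is surjective. -/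

import Mathlib

open scoped nonZeroDivisors

noncomputable section

/-! ### Star operations and star class groups

Throughout, the fractional ideals of a domain `R` with quotient field `K` are Mathlib's
`FractionalIdeal R⁰ K`, which include the zero ideal. -/

/-- A star operation on the integral domain `R` with quotient field `K`. A star operation is a map
on the *nonzero* fractional ideals; here it carries the (only possible) value `0` at the zero
ideal, so that it is a total map. -/
@[ext]
structure StarOperation (R K : Type*) [CommRing R] [IsDomain R] [Field K] [Algebra R K]
    [IsFractionRing R K] where
  toFun : FractionalIdeal R⁰ K → FractionalIdeal R⁰ K
  map_zero : toFun 0 = 0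
  map_principal : ∀ x : K, x ≠ 0 →
    toFun (FractionalIdeal.spanSingleton R⁰ x) = FractionalIdeal.spanSingleton R⁰ x
  map_smul : ∀ (x : K) (E : FractionalIdeal R⁰ K), x ≠ 0 → E ≠ 0 →
    toFun (FractionalIdeal.spanSingleton R⁰ x * E) = FractionalIdeal.spanSingleton R⁰ x * toFun E
  mono : ∀ E F : FractionalIdeal R⁰ K, E ≠ 0 → F ≠ 0 → E ≤ F → toFun E ≤ toFun F
  le_star : ∀ E : FractionalIdeal R⁰ K, E ≠ 0 → E ≤ toFun E
  idem : ∀ E : FractionalIdeal R⁰ K, E ≠ 0 → toFun (toFun E) = toFun E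

namespace StarOperation

section Basic

variable {R K : Type*} [CommRing R] [IsDomain R] [Field K] [Algebra R K] [IsFractionRing R K]

instance : CoeFun (StarOperation R K) (fun _ => FractionalIdeal R⁰ K → FractionalIdeal R⁰ K) :=
  ⟨StarOperation.toFun⟩

/-- `s` is of finite type: `E^s` is the union of the `F^s`, for `F` ranging over the nonzero
finitely generated fractional ideals contained in `E`. -/
def IsFiniteType (s : StarOperation R K) : Prop :=
  ∀ E : FractionalIdeal R⁰ K, E ≠ 0 → ∀ x : K,
    x ∈ s E ↔ ∃ F : FractionalIdeal R⁰ K,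
      F ≠ 0 ∧ (F : Submodule R K).FG ∧ F ≤ E ∧ x ∈ s F

/-- `E` is `s`-invertible: `(E E⁻¹)^s = R`. -/
def IsInvertible (s : StarOperation R K) (E : FractionalIdeal R⁰ K) : Prop :=
  s (E * E⁻¹) = 1

/-- `E` is an `s`-invertible `s`-ideal. -/
def IsInvStarIdeal (s : StarOperation R K) (E : FractionalIdeal R⁰ K) : Prop :=
  E ≠ 0 ∧ s E = E ∧ s.IsInvertible E

variable (s : StarOperation R K)

theorem le_star' (E : FractionalIdeal R⁰ K) : E ≤ s E := by
  by_cases hE : E = 0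
  · subst hE; exact FractionalIdeal.zero_le _
  · exact s.le_star E hE

theorem idem' (E : FractionalIdeal R⁰ K) : s (s E) = s E := by
  by_cases hE : E = 0
  · subst hE; rw [s.map_zero, s.map_zero]
  · exact s.idem E hE

theorem mono' {E F : FractionalIdeal R⁰ K} (h : E ≤ F) : s E ≤ s F := by
  by_cases hE : E = 0
  · subst hE; rw [s.map_zero]; exact FractionalIdeal.zero_le _
  · refine s.mono E F hE ?_ h
    rintro rfl
    exact hE (FractionalIdeal.le_zero_iff.1 h)

theorem map_smul' (x : K) (E : FractionalIdeal R⁰ K) :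
    s (FractionalIdeal.spanSingleton R⁰ x * E) = FractionalIdeal.spanSingleton R⁰ x * s E := by
  by_cases hE : E = 0
  · subst hE; simp [s.map_zero]
  by_cases hx : x = 0
  · subst hx; simp [s.map_zero]
  exact s.map_smul x E hx hE

theorem map_one : s 1 = 1 := by
  have h := s.map_principal 1 one_ne_zero
  rwa [FractionalIdeal.spanSingleton_one] at h

theorem ne_zero_star {E : FractionalIdeal R⁰ K} (hE : E ≠ 0) : s E ≠ 0 := by
  intro h
  have := s.le_star' E
  rw [h] at this
  exact hE (FractionalIdeal.le_zero_iff.1 this)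

theorem star_mul_le (E F : FractionalIdeal R⁰ K) : s E * F ≤ s (E * F) := by
  rw [FractionalIdeal.mul_le]
  intro i hi j hj
  have h1 : FractionalIdeal.spanSingleton R⁰ j * E ≤ E * F := by
    rw [mul_comm]
    gcongr
    exact FractionalIdeal.spanSingleton_le_iff_mem.2 hj
  have h2 := s.mono' h1
  rw [s.map_smul'] at h2
  rw [mul_comm i j]
  exact h2 (FractionalIdeal.mul_mem_mul (FractionalIdeal.mem_spanSingleton_self _ j) hi)

theorem star_star_mul (E F : FractionalIdeal R⁰ K) : s (s E * F) = s (E * F) := by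
  apply le_antisymm
  · rw [← s.idem' (E * F)]
    exact s.mono' (s.star_mul_le E F)
  · apply s.mono'
    gcongr
    exact s.le_star' E

theorem star_mul_star (E F : FractionalIdeal R⁰ K) : s (E * s F) = s (E * F) := by
  rw [mul_comm, s.star_star_mul, mul_comm]

theorem mul_inv_le_one (E : FractionalIdeal R⁰ K) : E * E⁻¹ ≤ 1 :=
  FractionalIdeal.mul_one_div_le_one

theorem inv_ne_zero' {E : FractionalIdeal R⁰ K} (hE : E ≠ 0) : E⁻¹ ≠ 0 := by
  intro h
  have := FractionalIdeal.bot_lt_mul_inv (I := E) hE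
  rw [h, mul_zero] at this
  exact lt_irrefl _ this

theorem star_inv (E : FractionalIdeal R⁰ K) : s E⁻¹ = E⁻¹ := by
  by_cases hE : E = 0
  · subst hE; rw [FractionalIdeal.inv_zero', s.map_zero]
  refine le_antisymm ?_ (s.le_star' _)
  rw [FractionalIdeal.inv_eq, FractionalIdeal.le_div_iff_mul_le hE]
  calc s (1 / E) * E ≤ s (1 / E * E) := s.star_mul_le _ _
    _ ≤ s 1 := s.mono' (by rw [mul_comm]; exact FractionalIdeal.mul_one_div_le_one)
    _ = 1 := s.map_one

theorem le_inv_inv (E : FractionalIdeal R⁰ K) : E ≤ E⁻¹⁻¹ := by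
  by_cases hE : E = 0
  · subst hE; exact FractionalIdeal.zero_le _
  rw [FractionalIdeal.inv_eq (I := E⁻¹), FractionalIdeal.le_div_iff_mul_le (inv_ne_zero' hE)]
  exact mul_inv_le_one E

theorem isInvStarIdeal_of_mul {E F : FractionalIdeal R⁰ K} (hE : s E = E)
    (hEF : s (E * F) = 1) : s.IsInvStarIdeal E := by
  have hE0 : E ≠ 0 := by
    rintro rfl
    rw [zero_mul, s.map_zero] at hEF
    exact zero_ne_one hEF
  refine ⟨hE0, hE, le_antisymm ?_ ?_⟩
  · rw [← s.map_one]
    exact s.mono' (mul_inv_le_one E)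
  · rw [← hEF]
    apply s.mono'
    gcongr
    rw [FractionalIdeal.inv_eq, FractionalIdeal.le_div_iff_mul_le hE0, mul_comm, ← hEF]
    exact s.le_star' _

/-- `Inv^s(R)`: the set of all `s`-invertible `s`-ideals of `R`. -/
def InvStar : Type _ := {E : FractionalIdeal R⁰ K // s.IsInvStarIdeal E}

variable {s}

@[ext]
theorem InvStar.ext {I J : s.InvStar} (h : I.1 = J.1) : I = J := Subtype.ext h

/-- `Inv^s(R)` is an abelian group under `(I, J) ↦ (I J)^s`, with unit `R`; the inverse of `I`
is `I⁻¹ = (R : I)`. -/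
instance : CommGroup s.InvStar where
  mul I J := ⟨s (I.1 * J.1), s.isInvStarIdeal_of_mul (F := I.1⁻¹ * J.1⁻¹) (s.idem' _) (by
    rw [s.star_star_mul, mul_mul_mul_comm, ← s.star_star_mul,
      show s (I.1 * I.1⁻¹) = 1 from I.2.2.2, one_mul]
    exact J.2.2.2)⟩
  one := ⟨1, s.isInvStarIdeal_of_mul (F := 1) s.map_one (by rw [mul_one, s.map_one])⟩
  inv I := ⟨I.1⁻¹, s.isInvStarIdeal_of_mul (F := I.1) (s.star_inv _) (by
    rw [mul_comm]; exact I.2.2.2)⟩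
  mul_assoc I J L := InvStar.ext (by
    change s (s (I.1 * J.1) * L.1) = s (I.1 * s (J.1 * L.1))
    rw [s.star_star_mul, s.star_mul_star, mul_assoc])
  one_mul I := InvStar.ext (by
    change s (1 * I.1) = I.1
    rw [one_mul]; exact I.2.2.1)
  mul_one I := InvStar.ext (by
    change s (I.1 * 1) = I.1
    rw [mul_one]; exact I.2.2.1)
  inv_mul_cancel I := InvStar.ext (by
    change s (I.1⁻¹ * I.1) = 1
    rw [mul_comm]; exact I.2.2.2)
  mul_comm I J := InvStar.ext (by
    change s (I.1 * J.1) = s (J.1 * I.1)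
    rw [mul_comm])

variable (s)

/-- The homomorphism `x ↦ xR` from the nonzero elements of `K` to `Inv^s(R)`. -/
def principal : Kˣ →* s.InvStar where
  toFun x := ⟨FractionalIdeal.spanSingleton R⁰ (x : K),
    s.isInvStarIdeal_of_mul (F := FractionalIdeal.spanSingleton R⁰ (x : K)⁻¹)
      (s.map_principal _ x.ne_zero) (by
        rw [FractionalIdeal.spanSingleton_mul_spanSingleton, mul_inv_cancel₀ x.ne_zero,
          FractionalIdeal.spanSingleton_one, s.map_one])⟩
  map_one' := InvStar.ext (by
    change FractionalIdeal.spanSingleton R⁰ (((1 : Kˣ) : K)) = 1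
    rw [Units.val_one, FractionalIdeal.spanSingleton_one])
  map_mul' x y := InvStar.ext (by
    change FractionalIdeal.spanSingleton R⁰ ((x * y : Kˣ) : K) =
      s (FractionalIdeal.spanSingleton R⁰ (x : K) * FractionalIdeal.spanSingleton R⁰ (y : K))
    rw [FractionalIdeal.spanSingleton_mul_spanSingleton, ← Units.val_mul,
      s.map_principal _ (x * y).ne_zero])

/-- The star class group `Cl^s(R)`: the group `Inv^s(R)` modulo its subgroup of nonzero principal
fractional ideals. -/
abbrev StarClassGroup : Type _ := s.InvStar ⧸ s.principal.range

variable {s} in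
/-- The class `[H]` in `Cl^s(R)` of an `s`-invertible `s`-ideal `H`. -/
def InvStar.toClass (H : s.InvStar) : s.StarClassGroup := QuotientGroup.mk H

theorem spanSingleton_mul_ne_zero {x : K} (hx : x ≠ 0) {E : FractionalIdeal R⁰ K} (hE : E ≠ 0) :
    FractionalIdeal.spanSingleton R⁰ x * E ≠ 0 := by
  intro h
  apply hE
  have h' := congrArg (fun I => FractionalIdeal.spanSingleton R⁰ x⁻¹ * I) h
  simp only [mul_zero] at h'
  rwa [← mul_assoc, FractionalIdeal.spanSingleton_mul_spanSingleton, inv_mul_cancel₀ hx,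
    FractionalIdeal.spanSingleton_one, one_mul] at h'

theorem inv_smul {x : K} (hx : x ≠ 0) (E : FractionalIdeal R⁰ K) :
    (FractionalIdeal.spanSingleton R⁰ x * E)⁻¹ = FractionalIdeal.spanSingleton R⁰ x⁻¹ * E⁻¹ := by
  have key : ∀ (y : K) (_ : y ≠ 0) (F : FractionalIdeal R⁰ K),
      FractionalIdeal.spanSingleton R⁰ y⁻¹ * F⁻¹ ≤ (FractionalIdeal.spanSingleton R⁰ y * F)⁻¹ := by
    intro y hy F
    by_cases hF : F = 0
    · subst hF; simp [FractionalIdeal.inv_zero']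
    have h0 : FractionalIdeal.spanSingleton R⁰ y * F ≠ 0 :=
      spanSingleton_mul_ne_zero hy hF
    rw [FractionalIdeal.inv_eq (I := FractionalIdeal.spanSingleton R⁰ y * F),
      FractionalIdeal.le_div_iff_mul_le h0, mul_mul_mul_comm,
      FractionalIdeal.spanSingleton_mul_spanSingleton, inv_mul_cancel₀ hy,
      FractionalIdeal.spanSingleton_one, one_mul, mul_comm]
    exact mul_inv_le_one F
  refine le_antisymm ?_ (key x hx E)
  have h := key x⁻¹ (inv_ne_zero hx) (FractionalIdeal.spanSingleton R⁰ x * E)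
  rw [← mul_assoc (FractionalIdeal.spanSingleton R⁰ x⁻¹),
    FractionalIdeal.spanSingleton_mul_spanSingleton, inv_mul_cancel₀ hx,
    FractionalIdeal.spanSingleton_one, one_mul, inv_inv] at h
  calc (FractionalIdeal.spanSingleton R⁰ x * E)⁻¹
      = FractionalIdeal.spanSingleton R⁰ x⁻¹ *
          (FractionalIdeal.spanSingleton R⁰ x * (FractionalIdeal.spanSingleton R⁰ x * E)⁻¹) := by
        rw [← mul_assoc, FractionalIdeal.spanSingleton_mul_spanSingleton, inv_mul_cancel₀ hx,
          FractionalIdeal.spanSingleton_one, one_mul]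
    _ ≤ _ := by gcongr

theorem inv_anti {E F : FractionalIdeal R⁰ K} (hE : E ≠ 0) (h : E ≤ F) : F⁻¹ ≤ E⁻¹ :=
  FractionalIdeal.inv_anti_mono hE (by
    rintro rfl
    exact hE (FractionalIdeal.le_zero_iff.1 h)) h

variable (R K) in
/-- The `v`-operation `E ↦ (E⁻¹)⁻¹`. -/
def vOp : StarOperation R K where
  toFun E := E⁻¹⁻¹
  map_zero := by rw [FractionalIdeal.inv_zero', FractionalIdeal.inv_zero']
  map_principal x _ := by
    rw [FractionalIdeal.spanSingleton_inv, FractionalIdeal.spanSingleton_inv, inv_inv]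
  map_smul x E hx _ := by rw [inv_smul hx, inv_smul (inv_ne_zero hx), inv_inv]
  mono E F hE hF h := inv_anti (inv_ne_zero' hF) (inv_anti hE h)
  le_star E _ := le_inv_inv E
  idem E hE := le_antisymm
    (inv_anti (inv_ne_zero' hE) (le_inv_inv E⁻¹)) (le_inv_inv _)

end Basic

/-! ### Extending ideals and star operations to an overring -/

section Overring

variable {R : Type*} (T : Type*) {K : Type*} [CommRing R] [IsDomain R] [CommRing T] [IsDomain T]
  [Field K] [Algebra R T] [Algebra R K] [Algebra T K] [IsScalarTower R T K]
  [IsFractionRing R K] [IsFractionRing T K]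


variable (R) in
/-- The conductor `(R : T)` is nonzero. -/
def HasNonzeroConductor : Prop :=
  ∃ r : R, r ≠ 0 ∧ ∀ t : T, ∃ r' : R, algebraMap R T r' = algebraMap R T r * t

variable {T}

/-- If the conductor `(R : T)` is nonzero, every fractional ideal of `T` is a fractional ideal of
`R`. -/
def restrictIdeal (hc : HasNonzeroConductor R T) (E : FractionalIdeal T⁰ K) :
    FractionalIdeal R⁰ K :=
  ⟨(E : Submodule T K).restrictScalars R, by
    have hRK := IsFractionRing.injective R K
    have hTK := IsFractionRing.injective T K
    obtain ⟨a, ha, hE⟩ := E.isFractional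
    obtain ⟨r, hr, hrT⟩ := hc
    obtain ⟨b, hb⟩ := hrT a
    have hr' : algebraMap R T r ≠ 0 := by
      intro h
      apply hr
      apply hRK
      rw [IsScalarTower.algebraMap_apply R T K, h, _root_.map_zero, _root_.map_zero]
    refine ⟨b, mem_nonZeroDivisors_of_ne_zero ?_, ?_⟩
    · rintro rfl
      rw [_root_.map_zero] at hb
      exact mul_ne_zero hr' (nonZeroDivisors.ne_zero ha) hb.symm
    · intro x hx
      obtain ⟨t, ht⟩ := hE x hx
      obtain ⟨c, hc'⟩ := hrT t
      refine ⟨c, ?_⟩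
      rw [IsScalarTower.algebraMap_apply R T K, hc', map_mul, ht, Algebra.smul_def,
        Algebra.smul_def, IsScalarTower.algebraMap_apply R T K b, hb, map_mul, mul_assoc]⟩

theorem mem_restrictIdeal (hc : HasNonzeroConductor R T) {E : FractionalIdeal T⁰ K} {x : K} :
    x ∈ restrictIdeal hc E ↔ x ∈ E := Iff.rfl

theorem restrictIdeal_ne_zero (hc : HasNonzeroConductor R T) {E : FractionalIdeal T⁰ K}
    (hE : E ≠ 0) : restrictIdeal hc E ≠ 0 := by
  intro h
  apply hE
  rw [FractionalIdeal.eq_zero_iff] at h ⊢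
  exact h

theorem restrictIdeal_smul (hc : HasNonzeroConductor R T) (x : K) (E : FractionalIdeal T⁰ K) :
    restrictIdeal hc (FractionalIdeal.spanSingleton T⁰ x * E) =
      FractionalIdeal.spanSingleton R⁰ x * restrictIdeal hc E := by
  ext y
  rw [mem_restrictIdeal, FractionalIdeal.mem_singleton_mul, FractionalIdeal.mem_singleton_mul]
  rfl

/-- The fractional ideal `E^s ∩ E^{v_T}` of `T`, for a fractional ideal `E` of `T`. -/
def extendFun (s : StarOperation R K) (hc : HasNonzeroConductor R T) (E : FractionalIdeal T⁰ K) :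
    FractionalIdeal T⁰ K :=
  ⟨{ carrier := {x | x ∈ s (restrictIdeal hc E) ∧ x ∈ vOp T K E}
     add_mem' := fun hx hy =>
      ⟨(s (restrictIdeal hc E) : Submodule R K).add_mem hx.1 hy.1,
        (vOp T K E : Submodule T K).add_mem hx.2 hy.2⟩
     zero_mem' := ⟨(s (restrictIdeal hc E) : Submodule R K).zero_mem,
      (vOp T K E : Submodule T K).zero_mem⟩
     smul_mem' := fun t x hx => by
      refine ⟨?_, (vOp T K E : Submodule T K).smul_mem t hx.2⟩
      have h1 : FractionalIdeal.spanSingleton R⁰ (algebraMap T K t) * restrictIdeal hc E ≤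
          restrictIdeal hc E := by
        rw [FractionalIdeal.spanSingleton_mul_le_iff]
        intro z hz
        rw [← Algebra.smul_def]
        exact (E : Submodule T K).smul_mem t ((mem_restrictIdeal hc).1 hz)
      have h2 := s.mono' h1
      rw [s.map_smul', FractionalIdeal.spanSingleton_mul_le_iff] at h2
      rw [Algebra.smul_def]
      exact h2 x hx.1 },
    FractionalIdeal.isFractional_of_le (J := vOp T K E) (fun _ hx => hx.2)⟩

theorem mem_extendFun (s : StarOperation R K) (hc : HasNonzeroConductor R T)
    {E : FractionalIdeal T⁰ K} {x : K} :
    x ∈ extendFun s hc E ↔ x ∈ s (restrictIdeal hc E) ∧ x ∈ vOp T K E := Iff.rfl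

/-- The extension `(s)_T : E ↦ E^s ∩ E^{v_T}` of a star operation `s` on `R` to an overring `T`
of `R` with nonzero conductor. -/
def extend (s : StarOperation R K) (hc : HasNonzeroConductor R T) : StarOperation T K where
  toFun := extendFun s hc
  map_zero := by
    rw [FractionalIdeal.eq_zero_iff]
    intro x hx
    have h : x ∈ vOp T K 0 := hx.2
    rwa [(vOp T K).map_zero, FractionalIdeal.mem_zero_iff] at h
  map_principal x hx := by
    ext y
    rw [mem_extendFun, (vOp T K).map_principal x hx]
    exact ⟨fun h => h.2, fun h => ⟨s.le_star' _ h, h⟩⟩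
  map_smul x E hx hE := by
    ext y
    rw [mem_extendFun, restrictIdeal_smul, s.map_smul', (vOp T K).map_smul',
      FractionalIdeal.mem_singleton_mul, FractionalIdeal.mem_singleton_mul,
      FractionalIdeal.mem_singleton_mul]
    constructor
    · rintro ⟨⟨z, hz, rfl⟩, ⟨w, hw, hzw⟩⟩
      obtain rfl := mul_left_cancel₀ hx hzw
      exact ⟨z, ⟨hz, hw⟩, rfl⟩
    · rintro ⟨z, ⟨hz, hw⟩, rfl⟩
      exact ⟨⟨z, hz, rfl⟩, ⟨z, hw, rfl⟩⟩
  mono E F _ _ h := fun x hx =>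
    ⟨s.mono' (E := restrictIdeal hc E) (F := restrictIdeal hc F) (fun _ hz => h hz) hx.1,
      (vOp T K).mono' h hx.2⟩
  le_star E _ := fun x hx =>
    ⟨s.le_star' (restrictIdeal hc E) hx, (vOp T K).le_star' E hx⟩
  idem E _ := by
    apply le_antisymm
    · intro x hx
      have h1 : restrictIdeal hc (extendFun s hc E) ≤ s (restrictIdeal hc E) :=
        fun _ hz => ((mem_extendFun s hc).1 hz).1
      have h2 : extendFun s hc E ≤ vOp T K E :=
        fun _ hz => ((mem_extendFun s hc).1 hz).2
      refine ⟨?_, ?_⟩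
      · rw [← s.idem' (restrictIdeal hc E)]
        exact s.mono' h1 hx.1
      · rw [← (vOp T K).idem' E]
        exact (vOp T K).mono' h2 hx.2
    · intro x hx
      exact ⟨s.le_star' (restrictIdeal hc _) hx, (vOp T K).le_star' _ hx⟩

variable (T)

/-- The ideal `HT` of `T` generated by a fractional ideal `H` of `R`. -/
def extendIdeal (H : FractionalIdeal R⁰ K) : FractionalIdeal T⁰ K :=
  ⟨Submodule.span T (H : Set K), by
    have hRK := IsFractionRing.injective R K
    obtain ⟨a, ha, hH⟩ := H.isFractional
    refine ⟨algebraMap R T a, mem_nonZeroDivisors_of_ne_zero ?_, ?_⟩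
    · intro h
      apply nonZeroDivisors.ne_zero ha
      apply hRK
      rw [IsScalarTower.algebraMap_apply R T K, h, _root_.map_zero, _root_.map_zero]
    · intro x hx
      induction hx using Submodule.span_induction with
      | mem x hx =>
        obtain ⟨r, hr⟩ := hH x hx
        exact ⟨algebraMap R T r, by
          rw [← IsScalarTower.algebraMap_apply, hr, algebraMap_smul]⟩
      | zero => exact ⟨0, by rw [_root_.map_zero, smul_zero]⟩
      | add x y _ _ hx hy => rw [smul_add]; exact IsLocalization.isInteger_add hx hy
      | smul t x _ hx =>
        rw [smul_comm]
        exact IsLocalization.isInteger_smul hx⟩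

end Overring

end StarOperation

/-! ### The pullback -/

section Pullback

variable {T : Type*} [CommRing T] (M : Ideal T) (D : Subring (T ⧸ M))

/-- `R = φ⁻¹(D)`, where `φ : T → T/M` is the canonical projection and `D` is a subring of `T/M`. -/
def pullbackRing : Subring T := D.comap (Ideal.Quotient.mk M)

variable {M} in
theorem mem_pullbackRing_of_mem {x : T} (hx : x ∈ M) : x ∈ pullbackRing M D := by
  change Ideal.Quotient.mk M x ∈ D
  rw [Ideal.Quotient.eq_zero_iff_mem.2 hx]
  exact D.zero_mem

/-- As `M ⊆ R` is a nonzero ideal of `T`, the conductor `(R : T)` is nonzero. -/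
theorem pullbackRing_conductor [NeZero M] :
    StarOperation.HasNonzeroConductor (pullbackRing M D) T := by
  obtain ⟨m, hm, hm0⟩ := Submodule.exists_mem_ne_zero_of_ne_bot (NeZero.ne M)
  refine ⟨⟨m, mem_pullbackRing_of_mem D hm⟩, fun h => hm0 (congrArg Subtype.val h), fun t => ?_⟩
  exact ⟨⟨m * t, mem_pullbackRing_of_mem D (M.mul_mem_right t hm)⟩, rfl⟩

/-- As `M` is nonzero, the quotient field of `T` is also the quotient field of `R`. -/
instance pullbackRing_isFractionRing [IsDomain T] [NeZero M] (K : Type*) [Field K] [Algebra T K]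
    [IsFractionRing T K] : IsFractionRing (pullbackRing M D) K := by
  obtain ⟨m, hm, hm0⟩ := Submodule.exists_mem_ne_zero_of_ne_bot (NeZero.ne M)
  have hTK := IsFractionRing.injective T K
  have hinj : Function.Injective (algebraMap (pullbackRing M D) K) := fun x y h =>
    Subtype.ext (hTK h)
  have hinj0 : ∀ x : pullbackRing M D, x ≠ 0 → algebraMap (pullbackRing M D) K x ≠ 0 :=
    fun x hx h => hx (hinj (by rw [h, map_zero]))
  refine (isLocalization_iff _ _).2 ⟨fun y => ?_, fun z => ?_, fun {x y} h => ?_⟩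
  · exact (hinj0 y (nonZeroDivisors.ne_zero y.2)).isUnit
  · obtain ⟨a, b, hb, rfl⟩ := IsFractionRing.div_surjective (A := T) z
    have hb0 : b ≠ 0 := nonZeroDivisors.ne_zero hb
    have hbK : algebraMap T K b ≠ 0 := fun h => hb0 (hTK (by rw [h, map_zero]))
    refine ⟨(⟨m * a, mem_pullbackRing_of_mem D (M.mul_mem_right a hm)⟩,
      ⟨⟨m * b, mem_pullbackRing_of_mem D (M.mul_mem_right b hm)⟩,
        mem_nonZeroDivisors_of_ne_zero fun h => mul_ne_zero hm0 hb0 (congrArg Subtype.val h)⟩), ?_⟩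
    change algebraMap T K a / algebraMap T K b * algebraMap T K (m * b) = algebraMap T K (m * a)
    rw [map_mul, map_mul]
    field_simp
  · exact ⟨1, by rw [hinj h]⟩

/-- The map `U(T) → k^• / U(D)` induced by the canonical projection `T → k = T/M`; here `k^•` is
the group of units of the field `k`. -/
def unitsToQuotient : Tˣ →* (T ⧸ M)ˣ ⧸ (Units.map (D.subtype : D →* T ⧸ M)).range :=
  (QuotientGroup.mk' _).comp (Units.map (Ideal.Quotient.mk M : T →* T ⧸ M))

end Pullback

end

/-! Everything rests on the conductor `M`. Because `D ≠ k`, the ideal `M` is closed under `s`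
(`star_pullbackIdeal`). Hence an ideal `I` with `I^s = R` is not contained in `M`, and it contains
some `f` that is invertible modulo `M`. As `fT + M = T`, an element `y` lies in a `T`-module `W` as
soon as `yI ⊆ W` and `My ⊆ W` (`mem_of_forall_mul_mem`); the second condition is checked in `R`,
where the star operation can be applied.

With `I = HH⁻¹` this test shows that `HT` is closed and invertible, and that `H ↦ HT` respects the
star products (`isInvStarIdeal_extendIdeal`, `extendIdeal_star_mul`).

For surjectivity, an invertible `L` has `LL⁻¹ ⊄ M`, so some multiple `aL` with `a ∈ L⁻¹` is an
integral ideal of `T` comaximal with `M`. Such an ideal contains some `h ≡ 1` modulo `M`. The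
splitting `1 = h + (1 - h)`, with `1 - h ∈ M`, transfers closedness and invertibility to `aL ∩ R`
and shows that this contraction extends back to `aL` (`exists_isInvStarIdeal_extendIdeal_eq`). -/

set_option linter.unusedSectionVars false

/-! ### Elementwise arithmetic of fractional ideals. -/

namespace FractionalIdeal

variable {R K : Type*} [CommRing R] [Field K] [Algebra R K]

theorem mul_mem_of_forall_mul {T : Type*} [CommRing T] [Algebra T K] {E F : FractionalIdeal R⁰ K}
    {W : FractionalIdeal T⁰ K} {y z : K}
    (h : ∀ e ∈ E, ∀ f ∈ F, y * (e * f) ∈ W) (hz : z ∈ E * F) : y * z ∈ W :=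
  FractionalIdeal.mul_induction_on hz (fun i hi j hj => h i hi j hj) fun a b ha hb => by
    rw [mul_add]; exact (W : Submodule T K).add_mem ha hb

theorem mem_of_forall_mul {T : Type*} [CommRing T] [Algebra T K] {E F : FractionalIdeal R⁰ K}
    {W : FractionalIdeal T⁰ K} {z : K}
    (h : ∀ e ∈ E, ∀ f ∈ F, e * f ∈ W) (hz : z ∈ E * F) : z ∈ W := by
  rw [← one_mul z]
  exact mul_mem_of_forall_mul (by simpa using h) hz

theorem algebraMap_mul_mem {E : FractionalIdeal R⁰ K} (r : R) {x : K} (hx : x ∈ E) :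
    algebraMap R K r * x ∈ E := by
  rw [← Algebra.smul_def]
  exact (E : Submodule R K).smul_mem r hx

theorem add_mem' {E : FractionalIdeal R⁰ K} {x y : K} (hx : x ∈ E) (hy : y ∈ E) : x + y ∈ E :=
  (E : Submodule R K).add_mem hx hy

theorem sub_mem' {E : FractionalIdeal R⁰ K} {x y : K} (hx : x ∈ E) (hy : y ∈ E) : x - y ∈ E :=
  (E : Submodule R K).sub_mem hx hy

theorem algebraMap_mem_one (r : R) : algebraMap R K r ∈ (1 : FractionalIdeal R⁰ K) :=
  (FractionalIdeal.mem_one_iff R⁰).2 ⟨r, rfl⟩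

variable [IsDomain R] [IsFractionRing R K]

theorem one_le_of_one_mem {E : FractionalIdeal R⁰ K} (h : (1 : K) ∈ E) : 1 ≤ E := by
  intro x hx
  obtain ⟨r, rfl⟩ := (FractionalIdeal.mem_one_iff R⁰).1 hx
  simpa using algebraMap_mul_mem r h

theorem mul_mem_one_of_mem_inv {E : FractionalIdeal R⁰ K} {x y : K} (hx : x ∈ E⁻¹) (hy : y ∈ E) :
    x * y ∈ (1 : FractionalIdeal R⁰ K) := by
  by_cases hE : E = 0
  · subst hE
    rw [FractionalIdeal.mem_zero_iff] at hy
    subst hy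
    rw [mul_zero]
    exact (1 : FractionalIdeal R⁰ K).zero_mem
  · exact (FractionalIdeal.mem_inv_iff hE).1 hx y hy

end FractionalIdeal

/-! ### Star closures and extension of ideals to an overring. -/

namespace StarOperation

section Basic

variable {R K : Type*} [CommRing R] [IsDomain R] [Field K] [Algebra R K] [IsFractionRing R K]
  (s : StarOperation R K)

/-- Star operations commute with scaling, so `yE ⊆ F` gives `y E^s = (yE)^s ⊆ F^s`. -/
theorem mul_mem_star {E F : FractionalIdeal R⁰ K} {y z : K} (h : ∀ e ∈ E, y * e ∈ F)
    (hz : z ∈ s E) : y * z ∈ s F := by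
  have h1 : FractionalIdeal.spanSingleton R⁰ y * E ≤ F :=
    FractionalIdeal.spanSingleton_mul_le_iff.2 h
  have h2 := s.mono' h1
  rw [s.map_smul'] at h2
  exact FractionalIdeal.spanSingleton_mul_le_iff.1 h2 z hz

theorem mem_star_of_forall_mul {I F : FractionalIdeal R⁰ K} (hI : s I = 1) {y : K}
    (h : ∀ e ∈ I, y * e ∈ F) : y ∈ s F := by
  have := s.mul_mem_star h (z := 1) (by rw [hI]; exact FractionalIdeal.one_mem_one R⁰)
  rwa [mul_one] at this

theorem mem_vOp_iff {E : FractionalIdeal R⁰ K} (hE : E ≠ 0) {x : K} :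
    x ∈ vOp R K E ↔ ∀ y ∈ E⁻¹, x * y ∈ (1 : FractionalIdeal R⁰ K) :=
  FractionalIdeal.mem_inv_iff (inv_ne_zero' hE)

theorem isInvertible_of_one_mem {E : FractionalIdeal R⁰ K} (h : (1 : K) ∈ s (E * E⁻¹)) :
    s.IsInvertible E := by
  refine le_antisymm ?_ (FractionalIdeal.one_le_of_one_mem h)
  rw [← s.map_one]
  exact s.mono' (mul_inv_le_one E)

end Basic

section Overring

variable {R : Type*} {T : Type*} {K : Type*} [CommRing R] [IsDomain R] [CommRing T] [IsDomain T]
  [Field K] [Algebra R T] [Algebra R K] [Algebra T K] [IsScalarTower R T K]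
  [IsFractionRing R K] [IsFractionRing T K]

theorem mem_extendIdeal {H : FractionalIdeal R⁰ K} {x : K} (hx : x ∈ H) : x ∈ extendIdeal T H :=
  Submodule.subset_span hx

/-- The multiplier `y` allows the induction to be applied to each factor of a product in turn. -/
theorem mul_mem_of_mem_extendIdeal {H : FractionalIdeal R⁰ K} {W : FractionalIdeal T⁰ K} {y : K}
    (h : ∀ x ∈ H, y * x ∈ W) {x : K} (hx : x ∈ extendIdeal T H) : y * x ∈ W := by
  change x ∈ Submodule.span T (H : Set K) at hx
  induction hx using Submodule.span_induction with
  | mem x hx => exact h x hx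
  | zero => rw [mul_zero]; exact W.zero_mem
  | add a b ha hb iha ihb =>
    rw [mul_add]; exact FractionalIdeal.add_mem' iha ihb
  | smul t a ha ih =>
    rw [Algebra.smul_def, mul_left_comm]
    exact FractionalIdeal.algebraMap_mul_mem t ih

theorem extendIdeal_le {H : FractionalIdeal R⁰ K} {W : FractionalIdeal T⁰ K}
    (h : ∀ x ∈ H, x ∈ W) : extendIdeal T H ≤ W := by
  intro x hx
  simpa using mul_mem_of_mem_extendIdeal (y := 1) (W := W) (by simpa using h) hx

theorem extendIdeal_ne_zero {H : FractionalIdeal R⁰ K} (hH : H ≠ 0) : extendIdeal T H ≠ 0 := by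
  intro h
  apply hH
  rw [FractionalIdeal.eq_zero_iff] at h ⊢
  exact fun x hx => h x (mem_extendIdeal hx)

theorem extendIdeal_mul_le {H J : FractionalIdeal R⁰ K} :
    extendIdeal T H * extendIdeal T J ≤ extendIdeal T (H * J) := by
  rw [FractionalIdeal.mul_le]
  intro h hh j hj
  refine mul_mem_of_mem_extendIdeal (fun j hj => ?_) hj
  rw [mul_comm h j]
  refine mul_mem_of_mem_extendIdeal (fun h hh => ?_) hh
  rw [mul_comm j h]
  exact mem_extendIdeal (FractionalIdeal.mul_mem_mul hh hj)

theorem extendIdeal_spanSingleton (x : K) :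
    extendIdeal T (FractionalIdeal.spanSingleton R⁰ x) = FractionalIdeal.spanSingleton T⁰ x := by
  apply le_antisymm
  · refine extendIdeal_le fun y hy => ?_
    obtain ⟨r, rfl⟩ := (FractionalIdeal.mem_spanSingleton R⁰).1 hy
    refine (FractionalIdeal.mem_spanSingleton T⁰).2 ⟨algebraMap R T r, ?_⟩
    rw [algebraMap_smul]
  · exact FractionalIdeal.spanSingleton_le_iff_mem.2
      (mem_extendIdeal (FractionalIdeal.mem_spanSingleton_self _ x))

theorem mem_inv_extendIdeal {H : FractionalIdeal R⁰ K} (hH : H ≠ 0) {x : K} (hx : x ∈ H⁻¹) :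
    x ∈ (extendIdeal T H)⁻¹ := by
  rw [FractionalIdeal.mem_inv_iff (extendIdeal_ne_zero hH)]
  refine fun y hy => mul_mem_of_mem_extendIdeal (fun z hz => ?_) hy
  obtain ⟨r, hr⟩ := (FractionalIdeal.mem_one_iff R⁰).1
    (FractionalIdeal.mul_mem_one_of_mem_inv hx hz)
  rw [← hr, IsScalarTower.algebraMap_apply R T K]
  exact FractionalIdeal.algebraMap_mem_one _

end Overring

end StarOperation

/-! ### The conductor `M` of the pullback under a star operation. -/

section Pullback

variable {T K : Type*} [CommRing T] [IsDomain T] [Field K] [Algebra T K] [IsFractionRing T K]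
  {M : Ideal T}

/-- The elements of a maximal ideal `M` together with one element outside it generate `T`. -/
theorem exists_one_sub_mul_mem [M.IsMaximal] {f : T} (hf : f ∉ M) : ∃ t, 1 - t * f ∈ M := by
  obtain ⟨y, i, hi, h⟩ := Ideal.IsMaximal.exists_inv ‹M.IsMaximal› hf
  exact ⟨y, by rw [← h]; simpa using hi⟩

namespace StarOperation

variable {D : Subring (T ⧸ M)} [NeZero M]

theorem algebraMap_mem_one_pullback {r : T} (hr : r ∈ pullbackRing M D) :
    algebraMap T K r ∈ (1 : FractionalIdeal (pullbackRing M D)⁰ K) :=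
  FractionalIdeal.algebraMap_mem_one (⟨r, hr⟩ : pullbackRing M D)

variable (s : StarOperation (pullbackRing M D) K)

/-- `M`, as a fractional ideal of the pullback ring. -/
abbrev pullbackIdeal (M : Ideal T) [NeZero M] (D : Subring (T ⧸ M)) (K : Type*) [Field K]
    [Algebra T K] [IsFractionRing T K] : FractionalIdeal (pullbackRing M D)⁰ K :=
  restrictIdeal (pullbackRing_conductor M D) (M : FractionalIdeal T⁰ K)

theorem mem_pullbackIdeal {x : K} :
    x ∈ pullbackIdeal M D K ↔ ∃ m ∈ M, algebraMap T K m = x := by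
  rw [mem_restrictIdeal, FractionalIdeal.mem_coeIdeal]

theorem algebraMap_mem_pullbackIdeal {m : T} :
    algebraMap T K m ∈ pullbackIdeal M D K ↔ m ∈ M := by
  rw [mem_pullbackIdeal]
  refine ⟨?_, fun h => ⟨m, h, rfl⟩⟩
  rintro ⟨m', hm', h⟩
  rwa [← IsFractionRing.injective T K h]

theorem mul_mem_pullbackIdeal {m : T} (hm : m ∈ M) {x : K} (hx : x ∈ (1 : FractionalIdeal T⁰ K)) :
    algebraMap T K m * x ∈ pullbackIdeal M D K := by
  obtain ⟨t, rfl⟩ := (FractionalIdeal.mem_one_iff T⁰).1 hx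
  rw [← map_mul, algebraMap_mem_pullbackIdeal]
  exact M.mul_mem_right t hm

theorem pullbackIdeal_le_one : pullbackIdeal M D K ≤ 1 := by
  intro x hx
  obtain ⟨m, hm, rfl⟩ := mem_pullbackIdeal.1 hx
  exact algebraMap_mem_one_pullback (mem_pullbackRing_of_mem D hm)

/-- `M = (R : T)` is closed under every star operation of the pullback `R`. -/
theorem star_pullbackIdeal [M.IsMaximal] (hD : D ≠ ⊤) :
    s (pullbackIdeal M D K) = pullbackIdeal M D K := by
  refine le_antisymm (fun x hx => ?_) (s.le_star' _)
  -- Since `tM ⊆ M ⊆ R`, applying `s` gives `t M^s ⊆ R`.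
  have key : ∀ t : T, algebraMap T K t * x ∈ (1 : FractionalIdeal (pullbackRing M D)⁰ K) := by
    intro t
    rw [← s.map_one]
    refine s.mul_mem_star (fun e he => pullbackIdeal_le_one ?_) hx
    obtain ⟨m, hm, rfl⟩ := mem_pullbackIdeal.1 he
    rw [← map_mul, algebraMap_mem_pullbackIdeal]
    exact M.mul_mem_left t hm
  obtain ⟨r, hr⟩ := (FractionalIdeal.mem_one_iff (pullbackRing M D)⁰).1 (key 1)
  rw [_root_.map_one, one_mul] at hr
  subst hr
  change algebraMap T K r ∈ _
  rw [algebraMap_mem_pullbackIdeal]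
  by_contra hrM
  -- If `r ∉ M`, an inverse `u` of `r` modulo `M` gives `t ≡ (tu)r` for every `t`. By `key` the
  -- right side lies in `R`, which forces `D = k`.
  obtain ⟨u, hu⟩ := exists_one_sub_mul_mem hrM
  apply hD
  rw [eq_top_iff]
  rintro y -
  obtain ⟨t, rfl⟩ := Ideal.Quotient.mk_surjective y
  obtain ⟨⟨r', hr'⟩, h⟩ := (FractionalIdeal.mem_one_iff (pullbackRing M D)⁰).1 (key (t * u))
  change algebraMap T K r' = algebraMap T K (t * u) * algebraMap T K r at h
  rw [← map_mul] at h
  have h' := IsFractionRing.injective T K h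
  subst h'
  have h2 : Ideal.Quotient.mk M t = Ideal.Quotient.mk M (t * u * r) := by
    rw [Ideal.Quotient.eq]
    convert M.mul_mem_left t hu using 1
    ring
  rw [h2]
  exact hr'

/-! ### Membership tests modulo ideals whose star closure is `R`. -/

/-- Otherwise `I ⊆ M`, and then `R = I^s ⊆ M^s = M`. -/
theorem exists_mem_notMem_of_star_eq_one [M.IsMaximal] (hD : D ≠ ⊤)
    {I : FractionalIdeal (pullbackRing M D)⁰ K} (hI : s I = 1) :
    ∃ f : T, f ∉ M ∧ algebraMap T K f ∈ I := by
  by_contra! h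
  have h1 : I ≤ pullbackIdeal M D K := by
    intro x hx
    have hx1 : x ∈ (1 : FractionalIdeal (pullbackRing M D)⁰ K) := hI ▸ s.le_star' I hx
    obtain ⟨r, rfl⟩ := (FractionalIdeal.mem_one_iff (pullbackRing M D)⁰).1 hx1
    by_contra hr
    exact h r (fun hrM => hr (algebraMap_mem_pullbackIdeal.2 hrM)) hx
  have h2 := s.mono' h1
  rw [hI, star_pullbackIdeal s hD] at h2
  have h3 : algebraMap T K 1 ∈ pullbackIdeal M D K := by
    rw [_root_.map_one]; exact h2 (FractionalIdeal.one_mem_one _)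
  rw [algebraMap_mem_pullbackIdeal] at h3
  exact Ideal.IsPrime.one_notMem inferInstance h3

/-- If `tf ≡ 1` modulo `M`, then `y = t(yf) + (1 - tf)y`. -/
theorem mem_of_notMem [M.IsMaximal] {W : FractionalIdeal T⁰ K} {y : K} {f : T} (hf : f ∉ M)
    (h1 : y * algebraMap T K f ∈ W) (h2 : ∀ m ∈ M, algebraMap T K m * y ∈ W) : y ∈ W := by
  obtain ⟨t, ht⟩ := exists_one_sub_mul_mem hf
  have h := FractionalIdeal.add_mem' (FractionalIdeal.algebraMap_mul_mem t h1) (h2 _ ht)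
  convert h using 1
  rw [map_sub, _root_.map_one, map_mul]
  ring

theorem mem_of_forall_mul_mem [M.IsMaximal] (hD : D ≠ ⊤)
    {I : FractionalIdeal (pullbackRing M D)⁰ K} (hI : s I = 1) {W : FractionalIdeal T⁰ K} {y : K}
    (h1 : ∀ i ∈ I, y * i ∈ W) (h2 : ∀ m ∈ M, algebraMap T K m * y ∈ W) : y ∈ W := by
  obtain ⟨f, hf, hfI⟩ := exists_mem_notMem_of_star_eq_one s hD hI
  exact mem_of_notMem hf (h1 _ hfI) h2

/-- From `yI ⊆ T` follows `MyI ⊆ M`, hence `My ⊆ M^s = M`. This supplies the second condition of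
`mem_of_forall_mul_mem`. -/
theorem mem_one_of_forall_mul_mem [M.IsMaximal] (hD : D ≠ ⊤)
    {I : FractionalIdeal (pullbackRing M D)⁰ K} (hI : s I = 1) {y : K}
    (h : ∀ i ∈ I, y * i ∈ (1 : FractionalIdeal T⁰ K)) : y ∈ (1 : FractionalIdeal T⁰ K) := by
  refine mem_of_forall_mul_mem s hD hI h fun m hm => ?_
  have h1 : algebraMap T K m * y ∈ s (pullbackIdeal M D K) := by
    refine s.mem_star_of_forall_mul hI fun i hi => ?_
    rw [mul_assoc]
    exact mul_mem_pullbackIdeal hm (h i hi)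
  rw [star_pullbackIdeal s hD] at h1
  obtain ⟨t, -, ht⟩ := mem_pullbackIdeal.1 h1
  rw [← ht]
  exact FractionalIdeal.algebraMap_mem_one t

/-- If `(HG)^s = R` for some `G`, then `H^s` is contained in `(HT)^{v_T}`. -/
theorem mul_mem_one_of_mem_star [M.IsMaximal] (hD : D ≠ ⊤)
    {H G : FractionalIdeal (pullbackRing M D)⁰ K} (hinv : s (H * G) = 1)
    {x z : K} (hx : ∀ h ∈ H, x * h ∈ (1 : FractionalIdeal T⁰ K))
    (hz : z ∈ s H) : x * z ∈ (1 : FractionalIdeal T⁰ K) := by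
  refine mem_one_of_forall_mul_mem s hD hinv fun i hi => ?_
  refine FractionalIdeal.mul_mem_of_forall_mul (fun h hh g hg => ?_) hi
  -- As `gH ⊆ R`, also `g H^s ⊆ R`. Thus `xz · hg = (gz)(xh)` is a product of an element of `R` and
  -- one of `T`.
  have h1 : g * z ∈ (1 : FractionalIdeal (pullbackRing M D)⁰ K) := by
    rw [← s.map_one]
    refine s.mul_mem_star (fun e he => ?_) hz
    rw [← hinv, mul_comm g e]
    exact s.le_star' _ (FractionalIdeal.mul_mem_mul he hg)
  obtain ⟨r, hr⟩ := (FractionalIdeal.mem_one_iff (pullbackRing M D)⁰).1 h1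
  have h2 := FractionalIdeal.algebraMap_mul_mem (r : T) (hx h hh)
  convert h2 using 1
  rw [show algebraMap T K (r : T) = g * z from hr]
  ring

/-! ### Extension of star-invertible ideals. -/

/-- The inclusions `H⁻¹ ⊆ (HT)⁻¹` and `HH⁻¹ ⊆ HT(HT)⁻¹` reduce both claims to tests against `HH⁻¹`,
whose `s`-closure is `R`. For closedness the `v`-component already suffices. -/
theorem isInvStarIdeal_extendIdeal [M.IsMaximal] (hD : D ≠ ⊤)
    {H : FractionalIdeal (pullbackRing M D)⁰ K} (hH : s.IsInvStarIdeal H) :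
    (s.extend (pullbackRing_conductor M D)).IsInvStarIdeal (extendIdeal T H) := by
  obtain ⟨h0, hs, hinv⟩ := hH
  have h0' : extendIdeal T H ≠ 0 := extendIdeal_ne_zero h0
  have hle : ∀ i ∈ H * H⁻¹, i ∈ extendIdeal T H * (extendIdeal T H)⁻¹ := by
    exact fun i hi => FractionalIdeal.mem_of_forall_mul (fun h hh g hg =>
      FractionalIdeal.mul_mem_mul (mem_extendIdeal hh) (mem_inv_extendIdeal h0 hg)) hi
  refine ⟨h0', le_antisymm (fun x hx => ?_) (le_star' _ _), isInvertible_of_one_mem _ ⟨?_, ?_⟩⟩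
  · have hx' := (mem_vOp_iff h0').1 hx.2
    refine mem_of_forall_mul_mem s hD hinv (fun i hi => ?_) fun m hm => mem_extendIdeal ?_
    · refine FractionalIdeal.mul_mem_of_forall_mul (fun h hh g hg => ?_) hi
      obtain ⟨t, ht⟩ := (FractionalIdeal.mem_one_iff T⁰).1 (hx' g (mem_inv_extendIdeal h0 hg))
      have := FractionalIdeal.algebraMap_mul_mem t (mem_extendIdeal (T := T) hh)
      convert this using 1
      rw [ht]; ring
    -- Here `xH⁻¹ ⊆ T`, so `mxH⁻¹ ⊆ M ⊆ R`. Therefore `mx · HH⁻¹ ⊆ H`, and `mx ∈ H^s = H`.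
    · rw [← hs]
      refine s.mem_star_of_forall_mul hinv fun i hi => ?_
      refine FractionalIdeal.mul_mem_of_forall_mul (fun h hh g hg => ?_) hi
      obtain ⟨r, hr⟩ := (FractionalIdeal.mem_one_iff (pullbackRing M D)⁰).1
        (pullbackIdeal_le_one (mul_mem_pullbackIdeal hm (hx' g (mem_inv_extendIdeal h0 hg))))
      have := FractionalIdeal.algebraMap_mul_mem r hh
      convert this using 1
      rw [hr]; ring
  · have h1 : H * H⁻¹ ≤ restrictIdeal (pullbackRing_conductor M D)
        (extendIdeal T H * (extendIdeal T H)⁻¹) := hle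
    have h2 := s.mono' h1
    rw [hinv] at h2
    exact h2 (FractionalIdeal.one_mem_one _)
  · rw [mem_vOp_iff fun h => ?_]
    · intro y hy
      rw [one_mul]
      exact mem_one_of_forall_mul_mem s hD hinv fun i hi =>
        FractionalIdeal.mul_mem_one_of_mem_inv hy (hle i hi)
    · have := FractionalIdeal.bot_lt_mul_inv h0'
      rw [h] at this
      exact lt_irrefl _ this

/-- The inclusion from left to right needs `(HJ)^s` inside the `v`-closure of `HT · JT`; this is
`mul_mem_one_of_mem_star` with `H⁻¹J⁻¹` as a star inverse of `HJ`. The other inclusion holds because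
`(HJ)^s T` is already closed. -/
theorem extendIdeal_star_mul [M.IsMaximal] (hD : D ≠ ⊤) (H J : s.InvStar) :
    extendIdeal T (s (H.1 * J.1)) =
      s.extend (pullbackRing_conductor M D) (extendIdeal T H.1 * extendIdeal T J.1) := by
  have hHJ : s.IsInvStarIdeal (s (H.1 * J.1)) := (H * J).2
  have hsub : ∀ i ∈ H.1 * J.1, i ∈ extendIdeal T H.1 * extendIdeal T J.1 := fun i hi =>
    FractionalIdeal.mem_of_forall_mul (fun h hh j hj =>
      FractionalIdeal.mul_mem_mul (mem_extendIdeal hh) (mem_extendIdeal hj)) hi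
  have hinv : s (H.1 * J.1 * (H.1⁻¹ * J.1⁻¹)) = 1 := by
    rw [mul_mul_mul_comm, ← s.star_star_mul, show s (H.1 * H.1⁻¹) = 1 from H.2.2.2, one_mul]
    exact J.2.2.2
  have hne : extendIdeal T H.1 * extendIdeal T J.1 ≠ 0 := by
    intro h0
    have hHJ0 : H.1 * J.1 = 0 := by
      rw [FractionalIdeal.eq_zero_iff] at h0 ⊢
      exact fun x hx => h0 x (hsub x hx)
    rw [hHJ0, zero_mul, s.map_zero] at hinv
    exact zero_ne_one hinv
  apply le_antisymm
  · refine extendIdeal_le fun x hx => ⟨s.mono' (show H.1 * J.1 ≤ restrictIdeal _ _ from hsub) hx, ?_⟩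
    rw [mem_vOp_iff hne]
    intro y hy
    rw [mul_comm x y]
    exact mul_mem_one_of_mem_star s hD hinv
      (fun h hh => FractionalIdeal.mul_mem_one_of_mem_inv hy (hsub h hh)) hx
  · rw [← (isInvStarIdeal_extendIdeal s hD hHJ).2.1]
    refine mono' _ (extendIdeal_mul_le.trans (extendIdeal_le fun x hx => ?_))
    exact mem_extendIdeal (s.le_star' _ hx)

/-! ### Surjectivity by contraction to `R`, and the induced homomorphism. -/

/-- For `T`-fractional ideals with `(LL⁻¹)^{(s)_T} = T`, the ideal `LL⁻¹` is not contained in `M`. -/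
theorem exists_mul_notMem [M.IsMaximal] (hD : D ≠ ⊤) {L : FractionalIdeal T⁰ K}
    (hL : (s.extend (pullbackRing_conductor M D)).IsInvertible L) :
    ∃ a ∈ L⁻¹, ∃ b ∈ L, ∃ f : T, f ∉ M ∧ algebraMap T K f = a * b := by
  by_contra! h
  -- Otherwise `LL⁻¹ ⊆ M`, and the `s`-component of the closure puts `1` in `M^s = M`.
  have h1 : restrictIdeal (pullbackRing_conductor M D) (L * L⁻¹) ≤ pullbackIdeal M D K := by
    intro x hx
    refine FractionalIdeal.mem_of_forall_mul (E := L) (F := L⁻¹) (fun b hb a ha => ?_) hx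
    obtain ⟨f, hf⟩ := (FractionalIdeal.mem_one_iff T⁰).1
      (FractionalIdeal.mul_mem_one_of_mem_inv ha hb)
    rw [mul_comm b a, ← hf, algebraMap_mem_pullbackIdeal]
    by_contra hfM
    exact h a ha b hb f hfM hf
  have h2 : (1 : K) ∈ s.extend (pullbackRing_conductor M D) (L * L⁻¹) := by
    rw [hL]; exact FractionalIdeal.one_mem_one _
  have h3 := s.mono' h1 h2.1
  rw [star_pullbackIdeal s hD] at h3
  have h4 : algebraMap T K 1 ∈ pullbackIdeal M D K := by
    rw [_root_.map_one]; exact h3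
  rw [algebraMap_mem_pullbackIdeal] at h4
  exact Ideal.IsPrime.one_notMem inferInstance h4

/-- The contraction `L ∩ R` of an integral `(s)_T`-invertible `(s)_T`-ideal `L` comaximal to `M`. -/
theorem exists_isInvStarIdeal_extendIdeal_eq [M.IsMaximal] (hD : D ≠ ⊤) {L : FractionalIdeal T⁰ K}
    (hL : (s.extend (pullbackRing_conductor M D)).IsInvStarIdeal L) (hL1 : L ≤ 1)
    {f : T} (hf : f ∉ M) (hfL : algebraMap T K f ∈ L) :
    ∃ H, s.IsInvStarIdeal H ∧ extendIdeal T H = L := by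
  obtain ⟨hL0, hLs, hLinv⟩ := hL
  obtain ⟨h, hm, hhL⟩ : ∃ h : T, 1 - h ∈ M ∧ algebraMap T K h ∈ L := by
    obtain ⟨t, ht⟩ := exists_one_sub_mul_mem hf
    refine ⟨t * f, ht, ?_⟩
    rw [map_mul]
    exact FractionalIdeal.algebraMap_mul_mem t hfL
  have hhR : h ∈ pullbackRing M D := by
    have := (pullbackRing M D).sub_mem (pullbackRing M D).one_mem (mem_pullbackRing_of_mem D hm)
    rwa [sub_sub_cancel] at this
  have hhM : h ∉ M := fun hh => Ideal.IsPrime.one_notMem (I := M) inferInstance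
    (by simpa using M.add_mem hm hh)
  set H : FractionalIdeal (pullbackRing M D)⁰ K :=
    restrictIdeal (pullbackRing_conductor M D) L ⊓ 1 with hHdef
  have memH : ∀ {x : K}, x ∈ H ↔ x ∈ L ∧ x ∈ (1 : FractionalIdeal (pullbackRing M D)⁰ K) :=
    Iff.rfl
  have hhH : algebraMap T K h ∈ H := memH.2 ⟨hhL, algebraMap_mem_one_pullback hhR⟩
  have hH0 : H ≠ 0 := by
    intro h0
    rw [h0, FractionalIdeal.mem_zero_iff] at hhH
    rw [(map_eq_zero_iff _ (IsFractionRing.injective T K)).1 hhH] at hhM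
    exact hhM M.zero_mem
  -- `M L⁻¹ ⊆ H⁻¹`, because `M L⁻¹ L ⊆ M ⊆ R`.
  have memHinv : ∀ {m : T}, m ∈ M → ∀ {x : K}, x ∈ L⁻¹ → algebraMap T K m * x ∈ H⁻¹ := by
    intro m hm x hx
    rw [FractionalIdeal.mem_inv_iff hH0]
    intro y hy
    rw [mul_assoc]
    exact pullbackIdeal_le_one
      (mul_mem_pullbackIdeal hm (FractionalIdeal.mul_mem_one_of_mem_inv hx (memH.1 hy).1))
  -- `l(1 - h) = l - lh` lies in `L`, and it lies in `M ⊆ R` because `1 - h ∈ M`.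
  have split : ∀ l : T, algebraMap T K l ∈ L → algebraMap T K (l * (1 - h)) ∈ H := by
    intro l hl
    refine memH.2 ⟨?_, algebraMap_mem_one_pullback
      (mem_pullbackRing_of_mem D (M.mul_mem_left l hm))⟩
    have := FractionalIdeal.sub_mem' hl (FractionalIdeal.algebraMap_mul_mem l hhL)
    rwa [← map_mul, ← map_sub, ← mul_one_sub] at this
  refine ⟨H, ⟨hH0, le_antisymm (fun y hy => ?_) (s.le_star' _), s.isInvertible_of_one_mem ?_⟩,
    le_antisymm (extendIdeal_le fun x hx => (memH.1 hx).1) fun x hx => ?_⟩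
  · have hy1 : y ∈ (1 : FractionalIdeal (pullbackRing M D)⁰ K) := by
      rw [← s.map_one]; exact s.mono' inf_le_right hy
    refine memH.2 ⟨?_, hy1⟩
    rw [← hLs]
    refine ⟨s.mono' inf_le_left hy, (mem_vOp_iff hL0).2 fun x hx => ?_⟩
    -- To obtain `xy ∈ T`, write `xy = (1 - h)xy + y(xh)`. The first term lies in `M^s = M`, the
    -- second in `RT = T`.
    have h1 : algebraMap T K (1 - h) * x * y ∈ s (pullbackIdeal M D K) := by
      refine s.mul_mem_star (fun e he => ?_) hy
      rw [mul_assoc]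
      exact mul_mem_pullbackIdeal hm (FractionalIdeal.mul_mem_one_of_mem_inv hx (memH.1 he).1)
    rw [star_pullbackIdeal s hD] at h1
    obtain ⟨m, -, hm'⟩ := mem_pullbackIdeal.1 h1
    obtain ⟨r, hr⟩ := (FractionalIdeal.mem_one_iff (pullbackRing M D)⁰).1 hy1
    have h2 := FractionalIdeal.add_mem' (FractionalIdeal.algebraMap_mem_one (K := K) m)
      (FractionalIdeal.algebraMap_mul_mem (r : T)
        (FractionalIdeal.mul_mem_one_of_mem_inv hx hhL))
    convert h2 using 1
    rw [hm', show algebraMap T K (r : T) = y from hr, map_sub, _root_.map_one]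
    ring
  · have h1 : algebraMap T K h ∈ s (H * H⁻¹) := by
      apply s.le_star'
      rw [← mul_one (algebraMap T K h)]
      refine FractionalIdeal.mul_mem_mul hhH ((FractionalIdeal.mem_inv_iff hH0).2 fun y hy => ?_)
      rw [one_mul]
      exact (memH.1 hy).2
    -- It suffices that `(1 - h)LL⁻¹ ⊆ HH⁻¹`, since `1 ∈ (LL⁻¹)^s`. On a product `tx` this is the
    -- identity `(1 - h)tx = h · t(1 - h)x + t(1 - h) · (1 - h)x`, where `h` and `t(1 - h)` lie in
    -- `H` and their cofactors in `M L⁻¹ ⊆ H⁻¹`.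
    have h2 : algebraMap T K (1 - h) * 1 ∈ s (H * H⁻¹) := by
      have hone : (1 : K) ∈ s.extend (pullbackRing_conductor M D) (L * L⁻¹) := by
        rw [hLinv]; exact FractionalIdeal.one_mem_one _
      refine s.mul_mem_star (fun e he => ?_) hone.1
      refine FractionalIdeal.mul_mem_of_forall_mul (E := L) (F := L⁻¹) (fun l hl x hx => ?_) he
      obtain ⟨t, rfl⟩ := (FractionalIdeal.mem_one_iff T⁰).1 (hL1 hl)
      have h3 := FractionalIdeal.add_mem'
        (FractionalIdeal.mul_mem_mul hhH (memHinv (M.mul_mem_left t hm) hx))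
        (FractionalIdeal.mul_mem_mul (split t hl) (memHinv hm hx))
      convert h3 using 1
      simp only [map_mul, map_sub, _root_.map_one]
      ring
    have h3 := FractionalIdeal.add_mem' h1 h2
    rwa [mul_one, ← map_add, add_sub_cancel, _root_.map_one] at h3
  · obtain ⟨t, rfl⟩ := (FractionalIdeal.mem_one_iff T⁰).1 (hL1 hx)
    -- `t = th + t(1 - h)`, with `h` and `t(1 - h)` both in `H`.
    have h3 := FractionalIdeal.add_mem'
      (FractionalIdeal.algebraMap_mul_mem t (mem_extendIdeal (T := T) hhH))
      (mem_extendIdeal (T := T) (split t hx))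
    convert h3 using 1
    rw [← map_mul, ← map_add]
    congr 1
    ring

/-- The homomorphism `H ↦ HT` from `Inv^s(R)` to `Inv^{(s)_T}(T)`. -/
noncomputable def extendHom [M.IsMaximal] (hD : D ≠ ⊤) :
    s.InvStar →* (s.extend (pullbackRing_conductor M D)).InvStar :=
  MonoidHom.mk' (fun H => ⟨extendIdeal T H.1, isInvStarIdeal_extendIdeal s hD H.2⟩)
    fun H J => InvStar.ext (extendIdeal_star_mul s hD H J)

theorem extendHom_principal [M.IsMaximal] (hD : D ≠ ⊤) (x : Kˣ) :
    extendHom s hD (s.principal x) = (s.extend (pullbackRing_conductor M D)).principal x :=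
  InvStar.ext (extendIdeal_spanSingleton (x : K))

/-- Scaling by `a ∈ L⁻¹` makes `L` integral, and the choice `ab ∉ M` with `b ∈ L` makes `aL`
comaximal with `M`, so the contraction argument applies to `aL`. -/
theorem exists_extendHom_eq_principal_mul [M.IsMaximal] (hD : D ≠ ⊤)
    (L : (s.extend (pullbackRing_conductor M D)).InvStar) :
    ∃ (x : Kˣ) (H : s.InvStar),
      extendHom s hD H = (s.extend (pullbackRing_conductor M D)).principal x * L := by
  obtain ⟨a, ha, b, hb, f, hf, hfab⟩ := exists_mul_notMem s hD L.2.2.2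
  have ha0 : a ≠ 0 := by
    rintro rfl
    rw [zero_mul, map_eq_zero_iff _ (IsFractionRing.injective T K)] at hfab
    exact hf (hfab ▸ M.zero_mem)
  have hval : ((s.extend (pullbackRing_conductor M D)).principal (Units.mk0 a ha0) * L).1 =
      FractionalIdeal.spanSingleton T⁰ a * L.1 := by
    change (s.extend (pullbackRing_conductor M D)) (FractionalIdeal.spanSingleton T⁰ a * L.1) = _
    rw [map_smul', L.2.2.1]
  have hinv := ((s.extend (pullbackRing_conductor M D)).principal (Units.mk0 a ha0) * L).2
  rw [hval] at hinv
  obtain ⟨H, hH, hHL⟩ := exists_isInvStarIdeal_extendIdeal_eq s hD hinv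
    (FractionalIdeal.spanSingleton_mul_le_iff.2 fun z hz =>
      FractionalIdeal.mul_mem_one_of_mem_inv ha hz) hf
    (by rw [hfab]; exact FractionalIdeal.mul_mem_mul (FractionalIdeal.mem_spanSingleton_self _ a) hb)
  exact ⟨Units.mk0 a ha0, ⟨H, hH⟩, InvStar.ext (hHL.trans hval.symm)⟩

end StarOperation

end Pullback

theorem mainTheorem3 {T K : Type*} [CommRing T] [IsDomain T] [Field K] [Algebra T K]
    [IsFractionRing T K] (M : Ideal T) [M.IsMaximal] [NeZero M] (D : Subring (T ⧸ M))
    (hD : D ≠ ⊤) [IsFractionRing D (T ⧸ M)]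
    (hunits : Function.Surjective (unitsToQuotient M D))
    (s : StarOperation (pullbackRing M D) K) (hs : s.IsFiniteType) :
    ∃ β : s.StarClassGroup →* (s.extend (pullbackRing_conductor M D)).StarClassGroup,
      (∀ H : s.InvStar,
        ∃ hHT : (s.extend (pullbackRing_conductor M D)).IsInvStarIdeal
            (StarOperation.extendIdeal T H.1),
          β H.toClass = StarOperation.InvStar.toClass ⟨StarOperation.extendIdeal T H.1, hHT⟩) ∧
      Function.Surjective β := by
  refine ⟨QuotientGroup.map _ _ (StarOperation.extendHom s hD) ?_, fun H =>
    ⟨StarOperation.isInvStarIdeal_extendIdeal s hD H.2, rfl⟩, fun c => ?_⟩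
  · rintro _ ⟨x, rfl⟩
    exact ⟨x, (StarOperation.extendHom_principal s hD x).symm⟩
  · obtain ⟨L, rfl⟩ := QuotientGroup.mk_surjective c
    obtain ⟨x, H, h⟩ := StarOperation.exists_extendHom_eq_principal_mul s hD L
    refine ⟨H.toClass, ?_⟩
    change QuotientGroup.mk (StarOperation.extendHom s hD H) = _
    rw [h, QuotientGroup.eq]
    exact ⟨x⁻¹, by rw [map_inv, mul_inv, inv_mul_cancel_right]⟩
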